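/- Work over $\mathbb{C}$, and let $\mathbb{C}^2$ have basis $\{x,y\}$ and dual basis $\{\partial_x,\partial_y\}$. For $d\ge 1$ let $W_d=x^{d-1}y\in S^d\mathbb{C}^2$. For $d_1,\dots,d_k\ge 1$ let $$\nu_{d_1,\dots,d_k}:(\mathbb{P}^1)^k\to\mathbb{P}(S^{d_1}\mathbb{C}^2\otimes\cdots\otimes S^{d_k}\mathbb{C}^2),\qquad ([v_1],\dots,[v_k])\mapsto[v_1^{d_1}\otimes\cdots\otimes v_k^{d_k}]$$ be the Segre–Veronese embedding. For a zero-dimensional scheme $A\subseteq(\mathbb{P}^1)^k$, the span $\langle\nu_{d_1,\dots,d_k}(A)\rangle$ is the zero locus of the linear forms in the homogeneous ideal of $\nu_{d_1,\dots,d_k}(A)$. The cactus rank $c_{d_1,\dots,d_k}(T)$ of a nonzero tensor $T$ is the least degree of a zero-dimensional scheme $A\subseteq(\mathbb{P}^1)^k$ with $[T]\in\langle\nu_{d_1,\dots,d_k}(A)\rangle$, and $A$ evinces the cactus rank of $T$ if $\deg A=c_{d_1,\dots,d_k}(T)$ and $[T]\in\langle\nu_{d_1,\dots,d_k}(A)\rangle$.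 Let $Z_1\subset\mathbb{P}^1$ be the scheme of degree $2$ supported at $[x]$, with ideal $(\partial_y^2)$, and let $Z_k=Z_1\times\cdots\times Z_1\subseteq(\mathbb{P}^1)^k$. Theorem. Let $k\ge 1$ and $d_i\ge 3$ for $1\le i\le k$, and let $T=W_{d_1}\otimes\cdots\otimes W_{d_k}$. Then $c_{d_1,\dots,d_k}(T)=2^k$, and $Z_k$ is the only zero-dimensional scheme in $(\mathbb{P}^1)^k$ that evinces the cactus rank of $T$. -/

import Mathlib

open scoped TensorProduct

namespace CactusRank

/-! ### Closed subschemes of `(ℙ¹)ᵏ` over `ℂ` -/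

/-- The multihomogeneous coordinate ring of `(ℙ¹)ᵏ`. The variables `X (i, 0)` and `X (i, 1)` are the
homogeneous coordinates `∂_{x_i}`, `∂_{y_i}` on the `i`-th factor: they take the values `α`, `β` at
the vector `α x + β y`. -/
abbrev CoordRing (k : ℕ) : Type := MvPolynomial (Fin k × Fin 2) ℂ

/-- The `ℕᵏ`-grading of the coordinate ring: both coordinates of the `i`-th factor have multidegree
`(0, …, 0, 1, 0, …, 0)`, with `1` at the `i`-th entry. -/
def weight (k : ℕ) : Fin k × Fin 2 → (Fin k → ℕ) := fun p => Pi.single p.1 1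

/-- The multihomogeneous forms of multidegree `a`, that is `H⁰(𝒪(a₁, …, a_k))`. -/
abbrev forms (k : ℕ) (a : Fin k → ℕ) : Submodule ℂ (CoordRing k) :=
  MvPolynomial.weightedHomogeneousSubmodule ℂ (weight k) a

noncomputable instance (k : ℕ) :
    GradedAlgebra (MvPolynomial.weightedHomogeneousSubmodule ℂ (weight k)) :=
  MvPolynomial.weightedGradedAlgebra ℂ (weight k)

/-- The irrelevant ideal of `(ℙ¹)ᵏ`, the intersection (and also the product) of the ideals
`(∂_{x_i}, ∂_{y_i})`. Its zero locus is the set of tuples of vectors one of which is zero. -/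
noncomputable def irrelevant (k : ℕ) : Ideal (CoordRing k) :=
  ⨅ i : Fin k, Ideal.span {MvPolynomial.X (i, 0), MvPolynomial.X (i, 1)}

/-- A closed subscheme `A` of `(ℙ¹)ᵏ`, given by the ideal `I_A` that cuts it out: the ideal generated
by all multihomogeneous forms that vanish on `A`. The ideals which arise in this way are exactly the
multihomogeneous ideals that are saturated with respect to the irrelevant ideal, and `A` and `I_A`
determine each other. -/
@[ext]
structure ClosedSubscheme (k : ℕ) where
  /-- The saturated multihomogeneous ideal `I_A`. -/
  ideal : Ideal (CoordRing k)
  homogeneous : ideal.IsHomogeneous (MvPolynomial.weightedHomogeneousSubmodule ℂ (weight k))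
  saturated : ∀ F : CoordRing k, (∀ G ∈ irrelevant k, F * G ∈ ideal) → F ∈ ideal

namespace ClosedSubscheme

variable {k : ℕ}

/-- The multigraded Hilbert function of `A`: the dimension of the multidegree `a` component of
`ℂ[∂_{x_1}, ∂_{y_1}, …, ∂_{x_k}, ∂_{y_k}] / I_A`. -/
noncomputable def hilbert (A : ClosedSubscheme k) (a : Fin k → ℕ) : ℕ :=
  Module.finrank ℂ (forms k a ⧸ (A.ideal.restrictScalars ℂ).comap (forms k a).subtype)

/-- `A` is zero-dimensional of degree `r`: its Hilbert polynomial is the constant `r`, i.e. its Hilbert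
function takes the value `r` in all sufficiently large multidegrees. (The empty scheme is included,
with `r = 0`.) -/
def IsZeroDimOfDegree (A : ClosedSubscheme k) (r : ℕ) : Prop :=
  ∀ᶠ a in Filter.atTop, A.hilbert a = r

end ClosedSubscheme

/-! ### Partially symmetric tensors and the Segre-Veronese embedding -/

/-- `S^d ℂ²`: binary forms of degree `d` in the basis `x = X 0`, `y = X 1` of `ℂ²`. -/
abbrev SymPow (d : ℕ) : Type := MvPolynomial.homogeneousSubmodule (Fin 2) ℂ d

/-- `S^{d_1} ℂ² ⊗ ⋯ ⊗ S^{d_k} ℂ²`. -/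
abbrev PartSymTensor {k : ℕ} (d : Fin k → ℕ) : Type := ⨂[ℂ] i, SymPow (d i)

/-- The power `(α x + β y)^d` in `S^d ℂ²` of the vector `v = (α, β)`. -/
noncomputable def powVec (d : ℕ) (v : Fin 2 → ℂ) : SymPow d :=
  ⟨(MvPolynomial.C (v 0) * MvPolynomial.X 0 + MvPolynomial.C (v 1) * MvPolynomial.X 1) ^ d, by
    rw [MvPolynomial.mem_homogeneousSubmodule]
    simpa using (((MvPolynomial.isHomogeneous_C_mul_X (v 0) (0 : Fin 2)).add
      (MvPolynomial.isHomogeneous_C_mul_X (v 1) (1 : Fin 2))).pow d)⟩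

/-- The Segre-Veronese map on vectors:
`(v_1, …, v_k) ↦ v_1^{d_1} ⊗ ⋯ ⊗ v_k^{d_k}`. -/
noncomputable def segreVeronese {k : ℕ} (d : Fin k → ℕ) (v : Fin k → Fin 2 → ℂ) : PartSymTensor d :=
  PiTensorProduct.tprod ℂ fun i => powVec (d i) (v i)

/-- `F` is the pullback, under the Segre-Veronese embedding, of the linear form `l`; `F` is determined
by this, and is a form of multidegree `d`. -/
def IsPullback {k : ℕ} (d : Fin k → ℕ) (l : Module.Dual ℂ (PartSymTensor d)) (F : CoordRing k) : Prop :=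
  ∀ v : Fin k → Fin 2 → ℂ, MvPolynomial.eval (fun p => v p.1 p.2) F = l (segreVeronese d v)

/-- The linear span `⟨ν_{d_1, …, d_k}(A)⟩` (as a linear subspace): the common zero locus of the linear
forms in the homogeneous ideal of the subscheme `ν_{d_1, …, d_k}(A)`, i.e. of the linear forms whose
pullback to `(ℙ¹)ᵏ` belongs to `I_A`. -/
def ClosedSubscheme.span {k : ℕ} (A : ClosedSubscheme k) (d : Fin k → ℕ) :
    Submodule ℂ (PartSymTensor d) where
  carrier := {T | ∀ (l : Module.Dual ℂ (PartSymTensor d)) (F : CoordRing k),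
    IsPullback d l F → F ∈ A.ideal → l T = 0}
  zero_mem' := fun l _ _ _ => map_zero l
  add_mem' := fun {S T} hS hT l F hF hA => by rw [map_add, hS l F hF hA, hT l F hF hA, add_zero]
  smul_mem' := fun c T hT l F hF hA => by rw [map_smul, hT l F hF hA, smul_zero]

/-- The cactus rank `c_{d_1, …, d_k}(T)`: the least degree of a zero-dimensional scheme
`A ⊆ (ℙ¹)ᵏ` with `T ∈ ⟨ν_{d_1, …, d_k}(A)⟩`. -/
noncomputable def cactusRank {k : ℕ} (d : Fin k → ℕ) (T : PartSymTensor d) : ℕ :=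
  sInf {r | ∃ A : ClosedSubscheme k, A.IsZeroDimOfDegree r ∧ T ∈ A.span d}

/-- `A` evinces the cactus rank of `T`: it is zero-dimensional of degree `c_{d_1, …, d_k}(T)`, and
`T ∈ ⟨ν_{d_1, …, d_k}(A)⟩`. -/
def Evinces {k : ℕ} (A : ClosedSubscheme k) (d : Fin k → ℕ) (T : PartSymTensor d) : Prop :=
  A.IsZeroDimOfDegree (cactusRank d T) ∧ T ∈ A.span d

/-! ### `W`-states and the scheme `Z_k` -/

/-- The `W`-state `W_d = x^{d-1} y` in `S^d ℂ²` for `d ≥ 1` (and `0` for `d = 0`). -/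
noncomputable def W : (d : ℕ) → SymPow d
  | 0 => 0
  | n + 1 => ⟨MvPolynomial.X 0 ^ n * MvPolynomial.X 1, by
      rw [MvPolynomial.mem_homogeneousSubmodule]
      simpa using ((MvPolynomial.isHomogeneous_X ℂ (0 : Fin 2)).pow n).mul
        (MvPolynomial.isHomogeneous_X ℂ (1 : Fin 2))⟩

/-- `W_{d_1} ⊗ ⋯ ⊗ W_{d_k}`. -/
noncomputable def tensorW {k : ℕ} (d : Fin k → ℕ) : PartSymTensor d :=
  PiTensorProduct.tprod ℂ fun i => W (d i)

/-- The ideal `(∂_y²)` of the scheme `Z_1 ⊆ ℙ¹` of degree `2` supported at the point `o_1 = [x]`. -/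
noncomputable def idealZ₁ : Ideal (MvPolynomial (Fin 2) ℂ) := Ideal.span {MvPolynomial.X 1 ^ 2}

/-- The ideal of `Z_k = Z_1 × ⋯ × Z_1`, the sum of the extensions of the ideal of `Z_1` along the
`k` projections `(ℙ¹)ᵏ → ℙ¹`. -/
noncomputable def idealZ (k : ℕ) : Ideal (CoordRing k) :=
  ⨆ i : Fin k, idealZ₁.map (MvPolynomial.rename (Prod.mk i)).toRingHom

theorem idealZ_eq (k : ℕ) : idealZ k =
    Ideal.span (Set.range fun i : Fin k => (MvPolynomial.X (i, 1) ^ 2 : CoordRing k)) := by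
  simp only [idealZ, idealZ₁, Ideal.map_span, Set.image_singleton]
  rw [← Ideal.span_iUnion]
  congr 1
  ext F
  simp [eq_comm]

theorem mem_idealZ_iff {k : ℕ} {F : CoordRing k} :
    F ∈ idealZ k ↔ ∀ m ∈ F.support, ∃ i : Fin k, 2 ≤ m (i, 1) := by
  have h : (Set.range fun i : Fin k => (MvPolynomial.X (i, 1) ^ 2 : CoordRing k)) =
      (fun s => MvPolynomial.monomial s (1 : ℂ)) ''
        (Set.range fun i : Fin k => Finsupp.single (i, (1 : Fin 2)) 2) := by
    rw [← Set.range_comp]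
    congr 1
    funext i
    simp [MvPolynomial.X_pow_eq_monomial]
  rw [idealZ_eq, h, MvPolynomial.mem_ideal_span_monomial_image]
  simp [Finsupp.single_le_iff]

/-- The zero-dimensional scheme `Z_k = Z_1 × ⋯ × Z_1 ⊆ (ℙ¹)ᵏ`. -/
noncomputable def Z (k : ℕ) : ClosedSubscheme k where
  ideal := idealZ k
  homogeneous := by
    rw [idealZ_eq]
    refine Ideal.homogeneous_span _ _ ?_
    rintro _ ⟨i, rfl⟩
    exact ⟨2 • weight k (i, 1), (MvPolynomial.isWeightedHomogeneous_X ℂ (weight k) (i, 1)).pow 2⟩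
  saturated := by
    intro F hF
    set e : Fin k × Fin 2 →₀ ℕ := ∑ i : Fin k, Finsupp.single (i, (0 : Fin 2)) 1 with he
    have hmem : MvPolynomial.monomial e (1 : ℂ) ∈ irrelevant k := by
      simp only [irrelevant, Ideal.mem_iInf]
      intro i
      have hi : Finsupp.single (i, (0 : Fin 2)) 1 ≤ e := by
        rw [he]
        exact Finset.single_le_sum
          (f := fun i : Fin k => Finsupp.single (i, (0 : Fin 2)) 1) (fun _ _ => zero_le)
          (Finset.mem_univ i)
      have hX : (MvPolynomial.X (i, 0) : CoordRing k) ∣ MvPolynomial.monomial e (1 : ℂ) :=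
        MvPolynomial.monomial_dvd_monomial.2 ⟨Or.inr hi, one_dvd _⟩
      exact Ideal.mem_of_dvd _ hX (Ideal.subset_span (by simp))
    have h := hF _ hmem
    rw [mem_idealZ_iff] at h ⊢
    intro m hm
    obtain ⟨i, hi⟩ := h (m + e) (by
      rw [MvPolynomial.mem_support_iff, MvPolynomial.coeff_mul_monomial, mul_one]
      exact MvPolynomial.mem_support_iff.1 hm)
    refine ⟨i, ?_⟩
    have : e (i, 1) = 0 := by
      rw [he, Finsupp.finsetSum_apply]
      exact Finset.sum_eq_zero fun j _ => by simp
    simpa [this] using hi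

end CactusRank

/-! By apolarity (`tensorW_mem_span_iff`), `T` lies in the span of `A` iff no form of multidegree
`d` in `I_A` involves the monomial dual to `T`. If `a ≤ d - 1`, a form of multidegree `a` in `I_A`
with a monomial of degree at most 1 in every `X (i, 1)` could be multiplied up to violate this, so
`I_A` lies inside `I_Z` there (`part_le_of_tensorW_mem_span`).

Hence the Hilbert function of `A` is at least that of `Z`, which is `2 ^ k` once `a ≥ 1`. Since
Hilbert functions are monotone (`hilbert_mono`), the degree of `A` is at least `2 ^ k`.

If the degree equals `2 ^ k`, the two ideals agree in every multidegree with `1 ≤ a ≤ d - 1`. As `d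
i ≥ 3`, such `a` may have an entry 2, where the generators of `I_Z` are visible. This gives `I_Z ≤
I_A` (`idealZ_le`); equal Hilbert functions in large multidegrees and saturation give equality. -/

namespace CactusRank

open MvPolynomial

/-! ### Multihomogeneous forms and their monomials -/

/-- The exponent vector of the monomial `∏ X_{i,0}^{p_i} X_{i,1}^{q_i}`. -/
noncomputable def biExp {k : ℕ} (p q : Fin k → ℕ) : Fin k × Fin 2 →₀ ℕ :=
  Finsupp.equivFunOnFinite.symm fun s => if s.2 = 0 then p s.1 else q s.1

@[simp] theorem biExp_zero {k : ℕ} (p q : Fin k → ℕ) (i : Fin k) : biExp p q (i, 0) = p i := by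
  simp [biExp]

@[simp] theorem biExp_one {k : ℕ} (p q : Fin k → ℕ) (i : Fin k) : biExp p q (i, 1) = q i := by
  simp [biExp]

theorem expVec_ext {k : ℕ} {m n : Fin k × Fin 2 →₀ ℕ} (h0 : ∀ i, m (i, 0) = n (i, 0))
    (h1 : ∀ i, m (i, 1) = n (i, 1)) : m = n := by
  ext ⟨i, j⟩
  fin_cases j
  exacts [h0 i, h1 i]

theorem weight_eq {k : ℕ} (m : Fin k × Fin 2 →₀ ℕ) (i : Fin k) :
    Finsupp.weight (weight k) m i = m (i, 0) + m (i, 1) := by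
  rw [Finsupp.weight_apply, Finsupp.sum_fintype _ _ (by simp), Finset.sum_apply,
    Fintype.sum_prod_type]
  simp [weight, Pi.single_apply]

theorem mem_forms_iff {k : ℕ} {a : Fin k → ℕ} {F : CoordRing k} :
    F ∈ forms k a ↔ ∀ m ∈ F.support, ∀ i, m (i, 0) + m (i, 1) = a i := by
  simp only [forms, mem_weightedHomogeneousSubmodule, IsWeightedHomogeneous, mem_support_iff,
    funext_iff, weight_eq]

theorem mul_mem_forms {k : ℕ} {a b : Fin k → ℕ} {F G : CoordRing k} (hF : F ∈ forms k a)
    (hG : G ∈ forms k b) : F * G ∈ forms k (a + b) :=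
  IsWeightedHomogeneous.mul hF hG

theorem monomial_mem_forms {k : ℕ} (p q : Fin k → ℕ) (c : ℂ) :
    monomial (biExp p q) c ∈ forms k (p + q) := by
  refine mem_forms_iff.2 fun m hm i => ?_
  rw [Finset.mem_singleton.1 (support_monomial_subset hm)]
  simp

instance forms_finite (k : ℕ) (a : Fin k → ℕ) : Module.Finite ℂ (forms k a) := by
  have hfin : {m : Fin k × Fin 2 →₀ ℕ | Finsupp.weight (weight k) m = a}.Finite := by
    refine (Set.finite_Iic (biExp a a)).subset fun m hm => ?_
    rintro ⟨i, j⟩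
    have := congrFun hm i
    rw [weight_eq] at this
    fin_cases j <;> simp <;> omega
  have := hfin.to_subtype
  let f : forms k a →ₗ[ℂ] ({m : Fin k × Fin 2 →₀ ℕ | Finsupp.weight (weight k) m = a} → ℂ) :=
    LinearMap.pi fun m => (lcoeff ℂ m.1).comp (forms k a).subtype
  refine Module.Finite.of_injective f ((injective_iff_map_eq_zero f).2 fun F hF => ?_)
  ext m
  by_contra hne
  exact hne (congrFun hF ⟨m, F.2 hne⟩)

/-! ### Hilbert functions and nonzerodivisors -/

namespace ClosedSubscheme

variable {k : ℕ} {A B : ClosedSubscheme k}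

/-- The forms of multidegree `a` in the ideal of `A`. -/
noncomputable abbrev part (a : Fin k → ℕ) : Submodule ℂ (forms k a) :=
  (A.ideal.restrictScalars ℂ).comap (forms k a).subtype

theorem mem_part {a : Fin k → ℕ} {F : forms k a} : F ∈ A.part a ↔ (F : CoordRing k) ∈ A.ideal :=
  Iff.rfl

theorem hilbert_add_finrank (A : ClosedSubscheme k) (a : Fin k → ℕ) :
    A.hilbert a + Module.finrank ℂ (A.part a) = Module.finrank ℂ (forms k a) :=
  Submodule.finrank_quotient_add_finrank _

theorem hilbert_le_of_part_le {a : Fin k → ℕ} (h : A.part a ≤ B.part a) :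
    B.hilbert a ≤ A.hilbert a := by
  have hA := A.hilbert_add_finrank a
  have hB := B.hilbert_add_finrank a
  have := Submodule.finrank_mono h
  omega

theorem part_eq_of_hilbert_eq {a : Fin k → ℕ} (h : A.part a ≤ B.part a)
    (he : B.hilbert a = A.hilbert a) : A.part a = B.part a := by
  have hA := A.hilbert_add_finrank a
  have hB := B.hilbert_add_finrank a
  exact Submodule.eq_of_le_of_finrank_eq h (by omega)

theorem hilbert_le_of_mul {a b : Fin k → ℕ} {G : CoordRing k} (hG : G ∈ forms k b)
    (hreg : ∀ F, F * G ∈ A.ideal → F ∈ A.ideal) : A.hilbert a ≤ A.hilbert (a + b) := by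
  let f : forms k a →ₗ[ℂ] forms k (a + b) :=
    { toFun := fun F => ⟨F * G, mul_mem_forms F.2 hG⟩
      map_add' := fun F F' => Subtype.ext (add_mul _ _ _)
      map_smul' := fun c F => Subtype.ext (smul_mul_assoc _ _ _) }
  have hf : A.part a = (A.part (a + b)).comap f := by
    ext F
    exact ⟨fun h => A.ideal.mul_mem_right G h, fun h => hreg _ h⟩
  refine LinearMap.finrank_le_finrank_of_injective
    (f := (A.part a).mapQ (A.part (a + b)) f hf.le) ?_
  rw [← LinearMap.ker_eq_bot, Submodule.ker_mapQ, ← hf, Submodule.mkQ_map_self]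

/-- Prime avoidance in linear form: the zero divisors modulo `I_A` are the union of finitely many
associated primes, and a vector space over an infinite field is not a finite union of proper
subspaces. -/
theorem exists_linear_regular (A : ClosedSubscheme k) (i : Fin k) :
    ∃ l ∈ forms k (Pi.single i 1), ∀ F, F * l ∈ A.ideal → F ∈ A.ideal := by
  classical
  let φ : (Fin 2 → ℂ) →ₗ[ℂ] CoordRing k :=
    Fintype.linearCombination ℂ fun j => (X (i, j) : CoordRing k)
  have hfin := associatedPrimes.finite (CoordRing k) (CoordRing k ⧸ A.ideal)
  let S : Finset (Submodule ℂ (Fin 2 → ℂ)) :=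
    hfin.toFinset.image fun p => (p.restrictScalars ℂ).comap φ
  -- An associated prime containing both coordinates of factor `i` contains the irrelevant ideal;
  -- saturation then puts its witness `f` in `I_A`, so the prime would be the unit ideal.
  have hS : ⊤ ∉ S := by
    simp only [S, Finset.mem_image, Set.Finite.mem_toFinset, not_exists, not_and]
    intro p hp htop
    have hX : ∀ j, (X (i, j) : CoordRing k) ∈ p := fun j => by
      have : Pi.single j (1 : ℂ) ∈ (p.restrictScalars ℂ).comap φ := htop ▸ Submodule.mem_top
      simpa [φ, Fintype.linearCombination_apply_single] using this
    have hirr : irrelevant k ≤ p := (iInf_le _ i).trans (Ideal.span_le.2 (by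
      rintro _ (rfl | rfl)
      exacts [hX 0, hX 1]))
    obtain ⟨hprime, x, hx⟩ := isAssociatedPrime_iff.1 (AssociatedPrimes.mem_iff.1 hp)
    obtain ⟨f, rfl⟩ := Ideal.Quotient.mk_surjective x
    have hkill : ∀ G, G ∈ p ↔ f * G ∈ A.ideal := fun G => by
      rw [hx, Submodule.mem_colon_singleton, Submodule.mem_bot, ← Ideal.Quotient.eq_zero_iff_mem,
        mul_comm, map_mul]
      rfl
    exact hprime.ne_top ((Ideal.eq_top_iff_one _).2 ((hkill 1).2 (by
      rw [mul_one]
      exact A.saturated f fun G hG => (hkill G).1 (hirr hG))))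
  obtain ⟨v, hv⟩ := (Set.ne_univ_iff_exists_notMem _).1 (Subspace.biUnion_ne_univ_of_top_notMem hS)
  refine ⟨φ v, ?_, fun F hF => ?_⟩
  · rw [Fintype.linearCombination_apply]
    exact Submodule.sum_mem _ fun j _ => Submodule.smul_mem _ _
      (isWeightedHomogeneous_X ℂ (weight k) (i, j))
  · by_contra hF'
    apply hv
    have : φ v ∈ ⋃ p ∈ associatedPrimes (CoordRing k) (CoordRing k ⧸ A.ideal), (p : Set _) := by
      rw [biUnion_associatedPrimes_eq_zero_divisors]
      refine ⟨Ideal.Quotient.mk _ F, fun h => hF' (Ideal.Quotient.eq_zero_iff_mem.1 h), ?_⟩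
      rw [mul_comm] at hF
      exact Ideal.Quotient.eq_zero_iff_mem.2 hF
    simp only [Set.mem_iUnion] at this ⊢
    obtain ⟨p, hp, hvp⟩ := this
    exact ⟨_, Finset.mem_image_of_mem _ (hfin.mem_toFinset.2 hp), hvp⟩

theorem exists_form_regular (A : ClosedSubscheme k) (b : Fin k → ℕ) :
    ∃ G ∈ forms k b, ∀ F, F * G ∈ A.ideal → F ∈ A.ideal := by
  choose l hl hreg using A.exists_linear_regular
  refine ⟨∏ i, l i ^ b i, ?_, ?_⟩
  · have h := IsWeightedHomogeneous.prod (w := weight k) Finset.univ (fun i => l i ^ b i)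
      (fun i => b i • Pi.single i 1) fun i _ => IsWeightedHomogeneous.pow (hl i) (b i)
    have hb : ∑ i, b i • (Pi.single i 1 : Fin k → ℕ) = b := by
      ext j
      simp [Finset.sum_apply, Pi.single_apply]
    rwa [hb] at h
  · have hpow : ∀ i n F, F * l i ^ n ∈ A.ideal → F ∈ A.ideal := by
      intro i n
      induction n with
      | zero => simp
      | succ n ih =>
        intro F hF
        rw [pow_succ, ← mul_assoc] at hF
        exact ih F (hreg i _ hF)
    have hprod : ∀ s : Finset (Fin k), ∀ F, F * ∏ i ∈ s, l i ^ b i ∈ A.ideal → F ∈ A.ideal := by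
      intro s
      induction s using Finset.induction_on with
      | empty => simp
      | insert i s hi ih =>
        intro F hF
        rw [Finset.prod_insert hi, ← mul_assoc] at hF
        exact hpow i _ F (ih _ hF)
    exact hprod _

theorem hilbert_mono (A : ClosedSubscheme k) : Monotone A.hilbert := by
  intro a b hab
  obtain ⟨G, hG, hreg⟩ := A.exists_form_regular (b - a)
  have := hilbert_le_of_mul (a := a) hG hreg
  rwa [add_tsub_cancel_of_le hab] at this

/-- An inclusion of saturated ideals may be checked in all large multidegrees. -/
theorem ideal_le_of_eventually (h : ∀ᶠ a in Filter.atTop, A.part a ≤ B.part a) :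
    A.ideal ≤ B.ideal := by
  obtain ⟨N, hN⟩ := Filter.eventually_atTop.1 h
  intro F hF
  rw [B.homogeneous.mem_iff]
  intro b
  obtain ⟨G, hG, hreg⟩ := B.exists_form_regular N
  -- A form regular modulo `I_B` moves the component of multidegree `b` into the range where the
  -- inclusion is known, and can then be cancelled.
  refine hreg _ (hN (b + N) le_add_self
    (show (⟨_, mul_mem_forms (SetLike.coe_mem _) hG⟩ : forms k (b + N)) ∈ A.part (b + N) from ?_))
  exact A.ideal.mul_mem_right _ (A.homogeneous.mem_iff.1 hF b)

end ClosedSubscheme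

/-! ### The Hilbert function of `Z` -/

/-- The monomials of degree at most 1 in each `X (i, 1)` form a basis of the quotient, one for each
`e : Fin k → Fin 2`; `a i ≥ 1` makes all of them available. -/
theorem hilbert_Z {k : ℕ} {a : Fin k → ℕ} (ha : ∀ i, 1 ≤ a i) : (Z k).hilbert a = 2 ^ k := by
  classical
  let E : (Fin k → Fin 2) → Fin k × Fin 2 →₀ ℕ := fun e =>
    biExp (fun i => a i - (e i : ℕ)) fun i => (e i : ℕ)
  have hE : ∀ e, monomial (E e) (1 : ℂ) ∈ forms k a := fun e => by
    have h := monomial_mem_forms (fun i => a i - (e i : ℕ)) (fun i => (e i : ℕ)) 1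
    convert h using 2
    ext i
    have := ha i
    simp only [Pi.add_apply]
    omega
  have hinj : Function.Injective E := fun e e' h => by
    ext i
    simpa [E] using DFunLike.congr_fun h (i, 1)
  let f : forms k a →ₗ[ℂ] ((Fin k → Fin 2) → ℂ) :=
    LinearMap.pi fun e => (lcoeff ℂ (E e)).comp (forms k a).subtype
  have hf : ∀ (F : forms k a) e, f F e = coeff (E e) (F : CoordRing k) := fun _ _ => rfl
  have hker : LinearMap.ker f = (Z k).part a := by
    ext F
    rw [LinearMap.mem_ker, ClosedSubscheme.mem_part]
    refine Iff.trans ?_ mem_idealZ_iff.symm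
    constructor
    · intro h m hm
      by_contra! hlt
      refine mem_support_iff.1 hm ?_
      have := congrFun h fun i => ⟨m (i, 1), hlt i⟩
      rw [hf, Pi.zero_apply] at this
      convert this using 2
      refine expVec_ext (fun i => ?_) fun i => ?_
      · have := mem_forms_iff.1 F.2 m hm i
        simp only [E, biExp_zero]
        omega
      · simp [E]
    · intro h
      ext e
      by_contra hne
      obtain ⟨i, hi⟩ := h (E e) (mem_support_iff.2 hne)
      simp only [E, biExp_one] at hi
      omega
  have hsurj : Function.Surjective f := fun c => by
    refine ⟨∑ e, c e • ⟨monomial (E e) 1, hE e⟩, ?_⟩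
    ext e
    simp [hf, coeff_sum, coeff_monomial, hinj.eq_iff]
  have := (f.quotKerEquivOfSurjective hsurj).finrank_eq
  rw [hker] at this
  exact this.trans (by simp)

theorem isZeroDimOfDegree_Z (k : ℕ) : (Z k).IsZeroDimOfDegree (2 ^ k) :=
  Filter.eventually_atTop.2 ⟨1, fun _ ha => hilbert_Z ha⟩

/-! ### Apolarity: linear forms on tensors and their pullbacks -/

/-- The exponent vector of the binary monomial `x^p y^q`. -/
noncomputable def binExp (p q : ℕ) : Fin 2 →₀ ℕ := Finsupp.single 0 p + Finsupp.single 1 q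

theorem binExp_inj {p q p' q' : ℕ} : binExp p q = binExp p' q' ↔ p = p' ∧ q = q' := by
  refine ⟨fun h => ⟨?_, ?_⟩, fun h => by rw [h.1, h.2]⟩
  · simpa [binExp] using DFunLike.congr_fun h 0
  · simpa [binExp] using DFunLike.congr_fun h 1

theorem X_pow_mul_X_pow (p q : ℕ) :
    (X 0 ^ p * X 1 ^ q : MvPolynomial (Fin 2) ℂ) = monomial (binExp p q) 1 := by
  simp [binExp, X_pow_eq_monomial, monomial_mul]

/-- The monomial `x^{d-j} y^j` in `S^d ℂ²`. -/
noncomputable def binMonomial (d : ℕ) (j : Fin (d + 1)) : SymPow d :=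
  ⟨monomial (binExp (d - j) j) 1, by
    rw [← X_pow_mul_X_pow, mem_homogeneousSubmodule]
    have h := ((isHomogeneous_X ℂ (0 : Fin 2)).pow (d - j)).mul
      ((isHomogeneous_X ℂ (1 : Fin 2)).pow (j : ℕ))
    convert h using 1
    have := j.2
    omega⟩

theorem powVec_eq_sum (d : ℕ) (v : Fin 2 → ℂ) :
    powVec d v = ∑ j : Fin (d + 1),
      ((d.choose j : ℂ) * (v 0 ^ (d - j : ℕ) * v 1 ^ (j : ℕ))) • binMonomial d j := by
  apply Subtype.ext
  rw [AddSubmonoidClass.coe_finsetSum]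
  simp only [powVec, binMonomial, SetLike.mk_smul_mk, ← X_pow_mul_X_pow]
  rw [add_comm, add_pow, Finset.sum_range]
  refine Finset.sum_congr rfl fun j _ => ?_
  rw [smul_eq_C_mul, map_mul, map_mul, map_pow, map_pow, map_natCast, mul_pow, mul_pow]
  ring

theorem W_eq {d : ℕ} (hd : 1 ≤ d) :
    (W d : MvPolynomial (Fin 2) ℂ) = monomial (binExp (d - 1) 1) 1 := by
  obtain ⟨n, rfl⟩ := Nat.exists_eq_add_of_le' hd
  rw [← X_pow_mul_X_pow]
  simp [W]

/-- The coefficient of `x^p y^q`, as a linear form on `S^d ℂ²`. -/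
noncomputable def binCoeff (d p q : ℕ) : SymPow d →ₗ[ℂ] ℂ :=
  (lcoeff ℂ (binExp p q)).comp (homogeneousSubmodule (Fin 2) ℂ d).subtype

theorem binCoeff_powVec {d p q : ℕ} (h : p + q = d) (v : Fin 2 → ℂ) :
    binCoeff d p q (powVec d v) = d.choose q * (v 0 ^ p * v 1 ^ q) := by
  subst h
  rw [powVec_eq_sum, map_sum, Finset.sum_eq_single ⟨q, by omega⟩]
  · simp [binCoeff, binMonomial]
  · intro j _ hj
    have : (j : ℕ) ≠ q := fun h => hj (Fin.ext h)
    simp [binCoeff, binMonomial, coeff_monomial, binExp_inj, this]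
  · simp

theorem binCoeff_W {d p q : ℕ} (hd : 1 ≤ d) :
    binCoeff d p q (W d) = if d - 1 = p ∧ 1 = q then 1 else 0 := by
  simp [binCoeff, W_eq hd, coeff_monomial, binExp_inj]

variable {k : ℕ} {d : Fin k → ℕ}

/-- The coefficient of `⨂ x_i^{p_i} y_i^{q_i}`, as a linear form on tensors. -/
noncomputable def tensorCoeff (d p q : Fin k → ℕ) : Module.Dual ℂ (PartSymTensor d) :=
  PiTensorProduct.lift ((MultilinearMap.mkPiAlgebra ℂ (Fin k) ℂ).compLinearMap
    fun i => binCoeff (d i) (p i) (q i))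

theorem tensorCoeff_tprod (p q : Fin k → ℕ) (s : ∀ i, SymPow (d i)) :
    tensorCoeff d p q (PiTensorProduct.tprod ℂ s) = ∏ i, binCoeff (d i) (p i) (q i) (s i) := by
  simp [tensorCoeff]

theorem eval_monomial_eq (m : Fin k × Fin 2 →₀ ℕ) (c : ℂ) (v : Fin k → Fin 2 → ℂ) :
    eval (fun p => v p.1 p.2) (monomial m c) =
      c * ∏ i, (v i 0 ^ m (i, 0) * v i 1 ^ m (i, 1)) := by
  rw [eval_monomial, Finsupp.prod_fintype _ _ (by simp), Fintype.prod_prod_type]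
  simp

/-- The exponent vector of the monomial dual to `⨂ x_i^{d_i-1} y_i`. -/
noncomputable abbrev wExp (d : Fin k → ℕ) : Fin k × Fin 2 →₀ ℕ := biExp (d - 1) 1

theorem tensorCoeff_tensorW (hd : ∀ i, 1 ≤ d i) (m : Fin k × Fin 2 →₀ ℕ) :
    tensorCoeff d (fun i => m (i, 0)) (fun i => m (i, 1)) (tensorW d) =
      if m = wExp d then 1 else 0 := by
  rw [tensorW, tensorCoeff_tprod]
  simp only [binCoeff_W (hd _)]
  split_ifs with h
  · simp [h]
  · by_contra hne
    have hall := Finset.prod_ne_zero_iff.1 hne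
    simp only [Finset.mem_univ, ne_eq, ite_eq_right_iff, one_ne_zero, imp_false, not_not,
      true_implies] at hall
    exact h (expVec_ext (fun i => by simp [← (hall i).1]) fun i => by simp [← (hall i).2])

/-- Pulling back a coefficient functional produces a monomial times a product of binomial
coefficients, nonzero in characteristic 0, so `l` is built from `F` by dividing these out. -/
theorem isPullback_exists (hd : ∀ i, 1 ≤ d i) {F : CoordRing k} (hF : F ∈ forms k d) :
    ∃ l : Module.Dual ℂ (PartSymTensor d), IsPullback d l F ∧
      (l (tensorW d) = 0 → coeff (wExp d) F = 0) := by
  classical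
  let N : (Fin k × Fin 2 →₀ ℕ) → ℂ := fun m => ∏ i, ((d i).choose (m (i, 1)) : ℂ)
  have hN : ∀ m ∈ F.support, N m ≠ 0 := fun m hm => Finset.prod_ne_zero_iff.2 fun i _ => by
    have := mem_forms_iff.1 hF m hm i
    exact_mod_cast (Nat.choose_pos (by omega)).ne'
  refine ⟨∑ m ∈ F.support, (coeff m F / N m) •
    tensorCoeff d (fun i => m (i, 0)) (fun i => m (i, 1)), fun v => ?_, fun h => ?_⟩
  · conv_lhs => rw [F.as_sum, map_sum]
    rw [LinearMap.sum_apply]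
    refine Finset.sum_congr rfl fun m hm => ?_
    rw [eval_monomial_eq, LinearMap.smul_apply, segreVeronese, tensorCoeff_tprod]
    simp only [binCoeff_powVec (mem_forms_iff.1 hF m hm _)]
    rw [Finset.prod_mul_distrib (f := fun i => ((d i).choose (m (i, 1)) : ℂ)), smul_eq_mul,
      ← mul_assoc, div_mul_cancel₀ _ (hN m hm)]
  · by_contra hne
    have hmem : wExp d ∈ F.support := mem_support_iff.2 hne
    simp only [LinearMap.sum_apply, LinearMap.smul_apply, tensorCoeff_tensorW hd, smul_eq_mul,
      mul_ite, mul_one, mul_zero, Finset.sum_ite_eq', hmem, if_true] at h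
    exact div_ne_zero hne (hN _ hmem) h

/-- The factor `∏ i, d i` is the product of the binomials `(d i).choose 1` from expanding the
powers. -/
theorem coeff_of_isPullback (hd : ∀ i, 1 ≤ d i) {l : Module.Dual ℂ (PartSymTensor d)}
    {F : CoordRing k} (h : IsPullback d l F) :
    coeff (wExp d) F = (∏ i, (d i : ℂ)) * l (tensorW d) := by
  classical
  let E : (∀ i, Fin (d i + 1)) → Fin k × Fin 2 →₀ ℕ := fun r =>
    biExp (fun i => d i - (r i : ℕ)) fun i => (r i : ℕ)
  let c : (∀ i, Fin (d i + 1)) → ℂ := fun r => (∏ i, ((d i).choose (r i) : ℂ)) *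
    l (PiTensorProduct.tprod ℂ fun i => binMonomial (d i) (r i))
  have hF : F = ∑ r, monomial (E r) (c r) := by
    refine MvPolynomial.funext fun w => ?_
    have hw := h fun i j => w (i, j)
    simp only [Prod.mk.eta] at hw
    rw [hw, segreVeronese]
    simp only [powVec_eq_sum]
    rw [MultilinearMap.map_sum, map_sum, map_sum]
    refine Finset.sum_congr rfl fun r _ => ?_
    have he := eval_monomial_eq (E r) (c r) fun i j => w (i, j)
    simp only [Prod.mk.eta] at he
    rw [he, MultilinearMap.map_smul_univ, map_smul, smul_eq_mul, Finset.prod_mul_distrib]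
    simp only [E, c, biExp_zero, biExp_one]
    ring
  let r₀ : ∀ i, Fin (d i + 1) := fun i => ⟨1, by have := hd i; omega⟩
  have hr₀ : E r₀ = wExp d := rfl
  rw [hF, coeff_sum, Finset.sum_eq_single r₀]
  · rw [hr₀, coeff_monomial, if_pos rfl]
    simp only [c, r₀, Nat.choose_one_right, tensorW]
    congr 4
    ext1 i
    exact Subtype.ext (W_eq (hd i)).symm
  · intro r _ hr
    rw [coeff_monomial, if_neg]
    intro he
    apply hr
    ext i
    simpa [E] using DFunLike.congr_fun he (i, 1)
  · simp

/-- The apolarity lemma for `W_{d_1} ⊗ ⋯ ⊗ W_{d_k}`. -/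
theorem tensorW_mem_span_iff (hd : ∀ i, 1 ≤ d i) (A : ClosedSubscheme k) :
    tensorW d ∈ A.span d ↔ ∀ F ∈ forms k d, F ∈ A.ideal → coeff (wExp d) F = 0 := by
  constructor
  · intro h F hF hA
    obtain ⟨l, hl, hl0⟩ := isPullback_exists hd hF
    exact hl0 (h l F hl hA)
  · intro h l F hl hA
    -- Homogeneity of `I_A` allows replacing `F` by its component of multidegree `d`, which contains
    -- the monomial `wExp d`.
    have hcomp := h _ (weightedHomogeneousComponent_mem (weight k) F d)
      (by
        have := A.homogeneous.mem_iff.1 hA d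
        rwa [show (DirectSum.decompose (weightedHomogeneousSubmodule ℂ (weight k)) F d : CoordRing k)
          = weightedHomogeneousComponent (weight k) d F from
            weightedDecomposition.decompose'_apply ℂ (weight k) F d] at this)
    rw [coeff_weightedHomogeneousComponent, if_pos, coeff_of_isPullback hd hl] at hcomp
    · refine (mul_eq_zero.1 hcomp).resolve_left (Finset.prod_ne_zero_iff.2 fun i _ => ?_)
      have := hd i
      exact_mod_cast (by omega : d i ≠ 0)
    · ext i
      have := hd i
      rw [weight_eq]
      simp
      omega

theorem tensorW_mem_span_Z (hd : ∀ i, 1 ≤ d i) : tensorW d ∈ (Z k).span d := by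
  refine (tensorW_mem_span_iff hd _).2 fun F _ hF => ?_
  by_contra hne
  obtain ⟨i, hi⟩ := mem_idealZ_iff.1 hF _ (mem_support_iff.2 hne)
  simp at hi

/-! ### Comparison with `Z`, the rank and uniqueness -/

theorem part_le_of_tensorW_mem_span (hd : ∀ i, 1 ≤ d i) {A : ClosedSubscheme k}
    (hA : tensorW d ∈ A.span d) {a : Fin k → ℕ} (ha : ∀ i, a i + 1 ≤ d i) :
    A.part a ≤ (Z k).part a := by
  intro F hF
  refine mem_idealZ_iff.2 fun m hm => ?_
  by_contra! hlt
  refine mem_support_iff.1 hm ?_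
  have hma := mem_forms_iff.1 F.2 m hm
  -- The complementary exponent, with `m + n = wExp d`: `m (i, 0) ≤ a i ≤ d i - 1` and `m (i, 1) ≤
  -- 1` keep the subtractions from truncating.
  set n : Fin k × Fin 2 →₀ ℕ := biExp (fun i => d i - 1 - m (i, 0)) fun i => 1 - m (i, 1) with hn
  have hG := mul_mem_forms F.2
    (monomial_mem_forms (fun i => d i - 1 - m (i, 0)) (fun i => 1 - m (i, 1)) 1)
  have hdeg : a + ((fun i => d i - 1 - m (i, 0)) + fun i => 1 - m (i, 1)) = d := by
    ext i
    have := hma i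
    have := hlt i
    have := ha i
    simp only [Pi.add_apply]
    omega
  rw [hdeg] at hG
  have h0 := (tensorW_mem_span_iff hd A).1 hA _ hG (A.ideal.mul_mem_right _ hF)
  have hexp : wExp d = m + n := by
    refine expVec_ext (fun i => ?_) fun i => ?_
    · have := hma i
      have := ha i
      simp [hn]
      omega
    · have := hlt i
      simp [hn]
      omega
  rwa [hexp, coeff_mul_monomial, mul_one] at h0

theorem hilbert_le_of_isZeroDimOfDegree {A : ClosedSubscheme k} {r : ℕ}
    (h : A.IsZeroDimOfDegree r) (a : Fin k → ℕ) : A.hilbert a ≤ r := by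
  obtain ⟨b, hb, hab⟩ := (h.and (Filter.eventually_ge_atTop a)).exists
  exact hb ▸ A.hilbert_mono hab

theorem two_pow_le_hilbert (hd : ∀ i, 1 ≤ d i) {A : ClosedSubscheme k}
    (hA : tensorW d ∈ A.span d) {a : Fin k → ℕ} (ha1 : ∀ i, 1 ≤ a i) (ha : ∀ i, a i + 1 ≤ d i) :
    2 ^ k ≤ A.hilbert a :=
  hilbert_Z ha1 ▸ ClosedSubscheme.hilbert_le_of_part_le (part_le_of_tensorW_mem_span hd hA ha)

theorem cactusRank_tensorW (hd : ∀ i, 2 ≤ d i) : cactusRank d (tensorW d) = 2 ^ k := by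
  have hd1 : ∀ i, 1 ≤ d i := fun i => one_le_two.trans (hd i)
  refine le_antisymm (Nat.sInf_le ⟨Z k, isZeroDimOfDegree_Z k, tensorW_mem_span_Z hd1⟩)
    (le_csInf ⟨_, Z k, isZeroDimOfDegree_Z k, tensorW_mem_span_Z hd1⟩ ?_)
  rintro r ⟨A, hr, hA⟩
  exact (two_pow_le_hilbert hd1 hA (a := 1) (fun _ => le_rfl) hd).trans
    (hilbert_le_of_isZeroDimOfDegree hr 1)

theorem idealZ_le (hd : ∀ i, 3 ≤ d i) {A : ClosedSubscheme k} (hr : A.IsZeroDimOfDegree (2 ^ k))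
    (hA : tensorW d ∈ A.span d) : idealZ k ≤ A.ideal := by
  classical
  have hd1 : ∀ i, 1 ≤ d i := fun i => le_trans (by norm_num) (hd i)
  rw [idealZ_eq, Ideal.span_le]
  rintro _ ⟨i, rfl⟩
  -- With this `b`, the form `X (i, 1) ^ 2 * G` has multidegree 2 at `i` and 1 elsewhere. All
  -- entries are at least 1, as `hilbert_Z` needs, and at most `d j - 1`; this is where `d j ≥ 3`
  -- enters.
  set b : Fin k → ℕ := 1 - Pi.single i 1 with hb
  obtain ⟨G, hG, hreg⟩ := A.exists_form_regular b
  refine hreg _ ?_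
  have hF := mul_mem_forms
    ((isWeightedHomogeneous_X ℂ (weight k) (i, (1 : Fin 2))).pow 2) hG
  set a : Fin k → ℕ := 2 • weight k (i, 1) + b with ha
  have hbound : ∀ j, 1 ≤ a j ∧ a j ≤ 2 := by
    intro j
    by_cases hj : j = i
    · subst hj
      simp [ha, hb, weight]
    · simp [ha, hb, weight, hj]
  have hda : ∀ j, a j + 1 ≤ d j := fun j => (Nat.succ_le_succ (hbound j).2).trans (hd j)
  have hpart := ClosedSubscheme.part_eq_of_hilbert_eq (part_le_of_tensorW_mem_span hd1 hA hda)
    (((hilbert_Z fun j => (hbound j).1).trans_le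
      (two_pow_le_hilbert hd1 hA (fun j => (hbound j).1) hda)).antisymm
      ((hilbert_le_of_isZeroDimOfDegree hr a).trans_eq (hilbert_Z fun j => (hbound j).1).symm))
  have hmem : (⟨_, hF⟩ : forms k a) ∈ (Z k).part a := by
    refine Ideal.mul_mem_right G (idealZ k) ?_
    rw [idealZ_eq]
    exact Ideal.subset_span ⟨i, rfl⟩
  exact hpart.ge hmem

theorem eq_Z (hd : ∀ i, 3 ≤ d i) {A : ClosedSubscheme k} (hr : A.IsZeroDimOfDegree (2 ^ k))
    (hA : tensorW d ∈ A.span d) : A = Z k := by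
  have hle : (Z k).ideal ≤ A.ideal := idealZ_le hd hr hA
  refine ClosedSubscheme.ext (le_antisymm (ClosedSubscheme.ideal_le_of_eventually ?_) hle)
  filter_upwards [hr, isZeroDimOfDegree_Z k] with a ha hZ
  exact (ClosedSubscheme.part_eq_of_hilbert_eq (A := Z k) (B := A)
    (Submodule.comap_mono hle) (ha.trans hZ.symm)).ge

end CactusRank

theorem mainTheorem5 (k : ℕ) (hk : 1 ≤ k) (d : Fin k → ℕ) (hd : ∀ i, 3 ≤ d i) :
    CactusRank.cactusRank d (CactusRank.tensorW d) = 2 ^ k ∧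
      ∀ A : CactusRank.ClosedSubscheme k,
        CactusRank.Evinces A d (CactusRank.tensorW d) ↔ A = CactusRank.Z k := by
  have hrank := CactusRank.cactusRank_tensorW fun i => le_trans (by norm_num) (hd i)
  refine ⟨hrank, fun A => ⟨fun h => CactusRank.eq_Z hd (hrank ▸ h.1) h.2, ?_⟩⟩
  rintro rfl
  exact ⟨hrank ▸ CactusRank.isZeroDimOfDegree_Z k,
    CactusRank.tensorW_mem_span_Z fun i => le_trans (by norm_num) (hd i)⟩
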